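/- Consider the synchronous message-passing model: every vertex of an $n$-vertex graph $G=(V,E)$ hosts a processor, the processors have distinct identity numbers in $\{1,\dots,n\}$, and in every round each processor sends a message of unbounded size over each of its incident edges, receives the messages sent to it, and performs arbitrary local computation at no cost. Initially a vertex knows only $n$, the parameter $k$, its own identity number and its degree (its incident edges being locally numbered). The running time is the number of rounds until all vertices have terminated. A set $U\subseteq V$ is dominating if every vertex of $V\setminus U$ has a neighbor in $U$, and it is an $\alpha$-approximate minimum dominating set if moreover $|U|\le\alpha\,|W|$ for a minimum-cardinality dominating set $W$ of $G$. **Theorem.** There are a deterministic distributed algorithm and absolute constants $C,c>0$ such that for every positive integer $k$ and every finite $n$-vertex graph $G$, with every assignment of identity numbers, the algorithm with parameter $k$ terminates within $(c\log n)^{k-1}$ rounds, and the set of vertices that it selects (each vertex outputs whether it belongs to the set) is a $C\,n^{1/k}$-approximate minimum dominating set of $G$. In other words, an $O(n^{1/k})$-approximation for the minimum dominating set problem can be computed in deterministic time $(O(\log n))^{k-1}$. -/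

import Mathlib

/-- A network on the graph `G`: every vertex hosts a processor, the processors have distinct
identity numbers in `{1, …, n}` with `n = |V|`, and every vertex `v` numbers the edges incident
on it by ports `0, …, deg v - 1`; `port v p` is the neighbour of `v` behind port `p`. -/
structure Network {V : Type*} [Fintype V] (G : SimpleGraph V) where
  id : V → ℕ
  id_injective : Function.Injective id
  id_mem : ∀ v, id v ∈ Finset.Icc 1 (Fintype.card V)
  deg : V → ℕ
  port : ∀ v, Fin (deg v) ≃ G.neighborSet v

/-- A deterministic algorithm of the synchronous message-passing model, with a global parameter of
type `Param` and a local output of type `Out`. Messages are unbounded and local computation is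
free. Initially a vertex knows the global parameter, the number `n` of vertices of the network, its
own identity number and its degree. In every round it sends a message through each of its ports
(`send s p` is the message for port `p`), receives the messages of its neighbours (`none` from
those that have terminated) and updates its state. It terminates as soon as `output` of its state
is `some o`; then `o` is its output. -/
structure DistributedAlgorithm (Param Out : Type) where
  State : Type
  Msg : Type
  init : Param → (n id deg : ℕ) → State
  send : State → ℕ → Msg
  receive : State → (d : ℕ) → (Fin d → Option Msg) → State
  output : State → Option Out

namespace DistributedAlgorithm

variable {Param Out : Type} (A : DistributedAlgorithm Param Out)
  {V : Type*} [Fintype V] {G : SimpleGraph V}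

/-- The message that `v` receives through its port `p`, when the vertices are in the states `s`:
the one that the neighbour `u` behind this port sends over the edge `{u, v}`, if `u` has not yet
terminated. -/
def received (N : Network G) (s : V → A.State) (v : V) (p : Fin (N.deg v)) : Option A.Msg :=
  let u : V := N.port v p
  let back : Fin (N.deg u) := (N.port u).symm ⟨v, SimpleGraph.Adj.symm (N.port v p).2⟩
  match A.output (s u) with
  | none => some (A.send (s u) back)
  | some _ => none

/-- One synchronous round. A vertex that has terminated keeps its state. -/
def round (N : Network G) (s : V → A.State) (v : V) : A.State :=
  match A.output (s v) with
  | none => A.receive (s v) (N.deg v) (A.received N s v)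
  | some _ => s v

/-- The states of the vertices after `t` rounds. -/
def stateAfter (N : Network G) (x : Param) : ℕ → V → A.State
  | 0 => fun v => A.init x (Fintype.card V) (N.id v) (N.deg v)
  | t + 1 => A.round N (stateAfter N x t)

/-- On the network `N` with the parameter `x`, all vertices have terminated after at most `T`
rounds, and the output of every vertex `v` is `out v`. -/
def ComputesWithin (N : Network G) (x : Param) (T : ℕ) (out : V → Out) : Prop :=
  ∀ v, A.output (A.stateAfter N x T v) = some (out v)

end DistributedAlgorithm

namespace SimpleGraph

variable {V : Type*} (G : SimpleGraph V)

/-- `U` is a dominating set of `G`: every vertex outside `U` has a neighbour in `U`. -/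
def IsDominatingSet (U : Finset V) : Prop :=
  ∀ v, v ∉ U → ∃ u ∈ U, G.Adj u v

/-- `W` is a minimum dominating set of `G`: a dominating set of minimum cardinality. -/
def IsMinDominatingSet (W : Finset V) : Prop :=
  G.IsDominatingSet W ∧ ∀ U : Finset V, G.IsDominatingSet U → W.card ≤ U.card

/-- `U` is an `α`-approximate minimum dominating set of `G`: a dominating set whose cardinality is
at most `α` times that of a minimum dominating set. -/
def IsApproxMinDominatingSet (α : ℝ) (U : Finset V) : Prop :=
  G.IsDominatingSet U ∧ ∀ W : Finset V, G.IsMinDominatingSet W → (U.card : ℝ) ≤ α * W.card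

/-- A finite graph has a minimum dominating set. -/
theorem exists_isMinDominatingSet [Fintype V] : ∃ W : Finset V, G.IsMinDominatingSet W := by
  classical
  obtain ⟨W, hW, hmin⟩ := Finset.exists_min_image
    ((Finset.univ : Finset (Finset V)).filter fun U => G.IsDominatingSet U) Finset.card
    ⟨Finset.univ, Finset.mem_filter.2 ⟨Finset.mem_univ _, fun v hv => absurd (Finset.mem_univ v) hv⟩⟩
  exact ⟨W, (Finset.mem_filter.1 hW).2, fun U hU => hmin U (by simp [hU])⟩

end SimpleGraph

/-! Let d = ⌈n^(1/k)⌉. Partition the vertices into clusters of small weak diameter such that every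
closed neighbourhood meets at most d clusters (`card_label_nbrs_le`), and let each cluster select a
smallest vertex set dominating its members. For a dominating set W, the members of W whose closed
neighbourhoods meet a cluster dominate it, so counting pairs of such a member and a cluster bounds
the selection by d|W| (`card_selected_le`).

The clusters arise in k - 1 phases. The vertices of the current cluster graph with more than d
neighbours get a ruling set whose neighbourhoods are disjoint. Whatever is within reach of a ruler
joins one, the rest retires, and the new clusters are contracted. Retiring clusters have at most d
neighbours. Disjointness divides the number of clusters by d in each phase
(`card_support_contract`), so at most d remain, as n ≤ d^k. Rulers found bit by bit from the
identity numbers are O(log n) away, so a phase multiplies radii by O(log n).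

The phases are not simulated by messages: every vertex gathers its surroundings and evaluates the
construction on what it sees. This is correct because selection depends only on a ball
(`Selected.of_agree`) that gathering covers (`known_sound_complete`, `lt_rounds`). -/

open Classical in
/-- An element of the set `s`, if there is one; it depends on nothing but `s`. -/
noncomputable def Set.pick {α : Type*} (s : Set α) : Option α :=
  if h : s.Nonempty then some h.some else none

theorem Set.mem_of_pick_eq_some {α : Type*} {s : Set α} {a : α} (h : s.pick = some a) : a ∈ s := by
  unfold Set.pick at h
  split_ifs at h with hs
  cases h
  exact hs.some_mem

theorem Set.pick_ne_none {α : Type*} {s : Set α} (h : s.Nonempty) : s.pick ≠ none := by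
  simp [Set.pick, h]

namespace LocalClustering

/-! ### Balls and agreement of relations on balls -/

section Balls

variable {α : Type*}

/-- `Ball P r a b`: there is a `P`-path of length at most `r` from `a` to `b`. -/
def Ball (P : α → α → Prop) : ℕ → α → α → Prop
  | 0, a, b => a = b
  | r + 1, a, b => ∃ c, Ball P r a c ∧ (c = b ∨ P c b)

/-- The relations `P` and `Q` agree at all points of the `P`-ball of radius `r` around `a`. -/
def Agree (P Q : α → α → Prop) (r : ℕ) (a : α) : Prop :=
  ∀ x, Ball P r a x → ∀ y, P x y ↔ Q x y

variable {P Q : α → α → Prop} {r s : ℕ} {a b c : α}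

theorem Ball.refl (r : ℕ) (a : α) : Ball P r a a := by
  induction r with
  | zero => rfl
  | succ r ih => exact ⟨a, ih, Or.inl rfl⟩

theorem Ball.trans (h : Ball P r a b) (h' : Ball P s b c) : Ball P (r + s) a c := by
  induction s generalizing c with
  | zero => cases h'; exact h
  | succ s ih =>
    obtain ⟨e, he, hec⟩ := h'
    exact ⟨e, ih he, hec⟩

theorem Ball.mono (hrs : r ≤ s) (h : Ball P r a b) : Ball P s a b := by
  obtain ⟨t, rfl⟩ := Nat.exists_eq_add_of_le hrs
  exact h.trans (Ball.refl t b)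

theorem Ball.single (h : P a b) : Ball P 1 a b := ⟨a, rfl, Or.inr h⟩

theorem Ball.symm (hs : ∀ a b, P a b → P b a) (h : Ball P r a b) : Ball P r b a := by
  induction r generalizing b with
  | zero => exact Eq.symm h
  | succ r ih =>
    obtain ⟨e, he, hec⟩ := h
    have h1 : Ball P 1 b e := by
      rcases hec with rfl | hec
      · exact Ball.refl 1 e
      · exact Ball.single (hs _ _ hec)
    exact (h1.trans (ih he)).mono (by omega)

/-- If every `Q`-edge is spanned by a `P`-path of length `s`, then `Q`-balls lie in `P`-balls. -/
theorem Ball.of_stretch (hQ : ∀ a b, Q a b → Ball P s a b) (h : Ball Q r a b) :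
    Ball P (s * r) a b := by
  induction r generalizing b with
  | zero => exact h
  | succ r ih =>
    obtain ⟨e, he, hec⟩ := h
    refine (ih he).trans ?_
    rcases hec with rfl | hec
    · exact Ball.refl _ _
    · exact hQ _ _ hec

theorem Agree.mono (hrs : r ≤ s) (h : Agree P Q s a) : Agree P Q r a :=
  fun x hx => h x (hx.mono hrs)

theorem Agree.shift (h : Agree P Q (r + s) a) (hb : Ball P s a b) : Agree P Q r b :=
  fun x hx => h x ((hb.trans hx).mono (by omega))

theorem Agree.here (h : Agree P Q r a) (b : α) : P a b ↔ Q a b := h a (Ball.refl r a) b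

/-- Every step of a path starts one short of its end at the latest, so balls agree one step beyond
radius `r`. -/
theorem Agree.ball_iff (h : Agree P Q r a) (hs : s ≤ r + 1) : Ball P s a b ↔ Ball Q s a b := by
  induction s generalizing b with
  | zero => rfl
  | succ s ih =>
    refine exists_congr fun e => ?_
    rw [← ih (by omega)]
    refine and_congr_right fun he => ?_
    rw [h e (he.mono (by omega)) b]

theorem Agree.symm (h : Agree P Q r a) : Agree Q P r a :=
  fun x hx y => (h x ((h.ball_iff (by omega)).2 hx) y).symm

end Balls

/-! ### Ruling sets, contraction and cluster labels -/

section Clusters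

variable {n : ℕ}

open Classical in
/-- The neighbours of `a` under `P`. -/
noncomputable def nbrs (P : Fin n → Fin n → Prop) (a : Fin n) : Finset (Fin n) :=
  Finset.univ.filter fun b => P a b

open Classical in
/-- The vertices of the reflexive graph `P`. -/
noncomputable def support (P : Fin n → Fin n → Prop) : Finset (Fin n) :=
  Finset.univ.filter fun a => P a a

/-- The candidates for the ruling set of the vertices with more than `d` neighbours that are left
when the first `b` bits of the identity numbers have been treated. -/
def Candidate (d : ℕ) (P : Fin n → Fin n → Prop) : ℕ → Fin n → Prop
  | 0, x => d < (nbrs P x).card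
  | b + 1, x => Candidate d P b x ∧ ((x : ℕ).testBit b = false ∨
      ∀ y, Candidate d P b y → (y : ℕ).testBit b = false → ¬ ∃ z, P x z ∧ P z y)

/-- The number of bits of the vertices. -/
def bits (n : ℕ) : ℕ := Nat.clog 2 n

/-- A ruling set of the vertices with more than `d` neighbours. -/
def Ruling (d : ℕ) (P : Fin n → Fin n → Prop) (x : Fin n) : Prop := Candidate d P (bits n) x

/-- The centre of the new cluster that `x` joins; it is `none` if `x` retires. -/
noncomputable def join (d : ℕ) (P : Fin n → Fin n → Prop) (x : Fin n) : Option (Fin n) :=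
  Set.pick {y | Ruling d P y ∧ Ball P (2 * bits n + 1) x y}

/-- The cluster graph on the centres. -/
def contract (d : ℕ) (P : Fin n → Fin n → Prop) (a b : Fin n) : Prop :=
  ∃ x y, join d P x = some a ∧ join d P y = some b ∧ P x y

/-- The name of the cluster of `a` after `m` further phases: the number of phases that were left
when the cluster retired, and its centre. -/
noncomputable def label (d : ℕ) : ℕ → (Fin n → Fin n → Prop) → Fin n → ℕ × Fin n
  | 0, _, a => (0, a)
  | m + 1, P, a =>
    match join d P a with
    | none => (m + 1, a)
    | some b => label d m (contract d P) b

variable {d m r : ℕ} {P Q : Fin n → Fin n → Prop} {a b x y : Fin n}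

theorem mem_nbrs : b ∈ nbrs P a ↔ P a b := by simp [nbrs]

theorem mem_support : a ∈ support P ↔ P a a := by simp [support]

theorem Agree.nbrs_eq (h : Agree P Q r a) : nbrs P a = nbrs Q a := by
  ext b
  rw [mem_nbrs, mem_nbrs, h.here b]

/-- Each bit looks only at candidates two steps away. -/
theorem Candidate.of_agree {l : ℕ} (h : Agree P Q (2 * l) x) :
    Candidate d P l x ↔ Candidate d Q l x := by
  induction l generalizing x with
  | zero => simp only [Candidate, h.nbrs_eq]
  | succ l ih =>
    simp only [Candidate]
    rw [ih (h.mono (by omega))]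
    refine and_congr_right fun _ => or_congr_right ?_
    refine forall_congr' fun y => ?_
    have key : (∃ z, P x z ∧ P z y) ↔ ∃ z, Q x z ∧ Q z y := by
      refine exists_congr fun z => ?_
      rw [← h.here z]
      exact and_congr_right fun hz => h z ((Ball.single hz).mono (by omega)) y
    rw [key]
    by_cases hy : ∃ z, Q x z ∧ Q z y
    · obtain ⟨z, hz, hzy⟩ := key.2 hy
      have : Ball P 2 x y := (Ball.single hz).trans (Ball.single hzy)
      rw [ih (h.shift (r := 2 * l) this)]
    · simp [hy]

theorem Candidate.high {l : ℕ} (h : Candidate d P l x) : d < (nbrs P x).card := by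
  induction l with
  | zero => exact h
  | succ l ih => exact ih h.1

/-- If two candidates at distance two differ in the current bit, the one with bit 1 is removed. -/
theorem Candidate.testBit_eq (hs : ∀ a b, P a b → P b a) {l : ℕ} (hx : Candidate d P l x)
    (hy : Candidate d P l y) (hxy : ∃ z, P x z ∧ P z y) :
    ∀ i < l, (x : ℕ).testBit i = (y : ℕ).testBit i := by
  induction l with
  | zero => intro i hi; omega
  | succ l ih =>
    intro i hi
    rcases Nat.lt_succ_iff_lt_or_eq.1 hi with hi | rfl
    · exact ih hx.1 hy.1 i hi
    · have hyx : ∃ z, P y z ∧ P z x := by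
        obtain ⟨z, h1, h2⟩ := hxy
        exact ⟨z, hs _ _ h2, hs _ _ h1⟩
      rcases Bool.eq_false_or_eq_true ((x : ℕ).testBit i) with h1 | h1 <;>
        rcases Bool.eq_false_or_eq_true ((y : ℕ).testBit i) with h2 | h2
      · rw [h1, h2]
      · rcases hx.2 with h | h
        · rw [h, h2]
        · exact absurd hxy (h y hy.1 h2)
      · rcases hy.2 with h | h
        · rw [h, h1]
        · exact absurd hyx (h x hx.1 h1)
      · rw [h1, h2]

theorem Ruling.eq_of_common (hs : ∀ a b, P a b → P b a) (hx : Ruling d P x) (hy : Ruling d P y)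
    {z : Fin n} (hxz : P x z) (hyz : P y z) : x = y := by
  refine Fin.ext (Nat.eq_of_testBit_eq fun i => ?_)
  rcases lt_or_ge i (bits n) with hi | hi
  · exact Candidate.testBit_eq hs hx hy ⟨z, hxz, hs _ _ hyz⟩ i hi
  · have key : ∀ w : Fin n, (w : ℕ) < 2 ^ i := fun w =>
      (w.2.trans_le (Nat.le_pow_clog (by norm_num) n)).trans_le
        (Nat.pow_le_pow_right (by norm_num) hi)
    rw [Nat.testBit_lt_two_pow (key x), Nat.testBit_lt_two_pow (key y)]

/-- A candidate is removed only because of one two steps away with bit 0, which itself survives. -/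
theorem exists_candidate (l : ℕ) (h : d < (nbrs P x).card) :
    ∃ y, Candidate d P l y ∧ Ball P (2 * l) x y := by
  induction l with
  | zero => exact ⟨x, h, rfl⟩
  | succ l ih =>
    obtain ⟨y, hy, hxy⟩ := ih
    by_cases hc : Candidate d P (l + 1) y
    · exact ⟨y, hc, hxy.mono (by omega)⟩
    · simp only [Candidate, not_and, not_or] at hc
      obtain ⟨-, hc⟩ := hc hy
      push Not at hc
      obtain ⟨z, hz, hz0, w, hyw, hwz⟩ := hc
      exact ⟨z, ⟨hz, Or.inl hz0⟩, hxy.trans ((Ball.single hyw).trans (Ball.single hwz))⟩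

theorem join_ruling (h : join d P x = some a) : Ruling d P a := (Set.mem_of_pick_eq_some h).1

theorem join_ball (h : join d P x = some a) : Ball P (2 * bits n + 1) x a :=
  (Set.mem_of_pick_eq_some h).2

/-- The extra 1 in the joining radius is spent here: neighbours of a high-degree vertex must not
retire either. -/
theorem join_ne_none (hyx : d < (nbrs P y).card) (h : P x y) : join d P x ≠ none := by
  obtain ⟨z, hz, hyz⟩ := exists_candidate (bits n) hyx
  exact Set.pick_ne_none ⟨z, hz, ((Ball.single h).trans hyz).mono (by omega)⟩

theorem join_congr (h : Agree P Q (4 * bits n + 1) x) : join d P x = join d Q x := by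
  unfold join
  congr 1
  ext y
  simp only [Set.mem_ofPred_eq]
  rw [← h.ball_iff (b := y) (s := 2 * bits n + 1) (by omega), and_comm,
    and_comm (a := Ruling d Q y)]
  refine and_congr_right fun hy => Candidate.of_agree ?_
  exact Agree.shift (s := 2 * bits n + 1) (h.mono (by omega)) hy

theorem contract_symm (hs : ∀ a b, P a b → P b a) (a b : Fin n) (h : contract d P a b) :
    contract d P b a := by
  obtain ⟨x, y, hx, hy, hxy⟩ := h
  exact ⟨y, x, hy, hx, hs _ _ hxy⟩

theorem contract_refl (hr : ∀ a b, P a b → P a a) (a b : Fin n) (h : contract d P a b) :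
    contract d P a a := by
  obtain ⟨x, y, hx, hy, hxy⟩ := h
  exact ⟨x, x, hx, hx, hr _ _ hxy⟩

theorem contract_stretch (hs : ∀ a b, P a b → P b a) (a b : Fin n) (h : contract d P a b) :
    Ball P (4 * bits n + 3) a b := by
  obtain ⟨x, y, hx, hy, hxy⟩ := h
  exact ((((join_ball hx).symm hs).trans (Ball.single hxy)).trans (join_ball hy)).mono (by omega)

/-- The radius adds `2 * bits n + 1` to reach `x`, 1 to cross to `y`, and `4 * bits n + 1` to
determine its centre. -/
theorem contract_of_agree (hs : ∀ a b, P a b → P b a) (h : Agree P Q (6 * bits n + 3) a)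
    (hab : contract d P a b) : contract d Q a b := by
  obtain ⟨x, y, hx, hy, hxy⟩ := hab
  have hax := (join_ball hx).symm hs
  have hxA : Agree P Q (4 * bits n + 2) x :=
    Agree.shift (s := 2 * bits n + 1) (h.mono (by omega)) hax
  have hyA : Agree P Q (4 * bits n + 1) y := Agree.shift (s := 1) hxA (Ball.single hxy)
  exact ⟨x, y, by rw [← join_congr (hxA.mono (by omega)), hx], by rw [← join_congr hyA, hy],
    (hxA.here y).1 hxy⟩

theorem Agree.contract (hP : ∀ a b, P a b → P b a) (hQ : ∀ a b, Q a b → Q b a)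
    (h : Agree P Q ((6 * bits n + 3) + (4 * bits n + 3) * r) a) :
    Agree (contract d P) (contract d Q) r a := by
  intro x hx y
  have hA : Agree P Q (6 * bits n + 3) x := h.shift (hx.of_stretch (contract_stretch hP))
  exact ⟨contract_of_agree hP hA, contract_of_agree hQ hA.symm⟩

/-- The radius that determines the label after `m` phases. -/
def labelRadius (n : ℕ) : ℕ → ℕ
  | 0 => 0
  | m + 1 => (8 * bits n + 4) + (4 * bits n + 3) * labelRadius n m

theorem label_congr (hP : ∀ a b, P a b → P b a) (hQ : ∀ a b, Q a b → Q b a)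
    (h : Agree P Q (labelRadius n m) a) : label d m P a = label d m Q a := by
  induction m generalizing P Q a with
  | zero => rfl
  | succ m ih =>
    simp only [labelRadius] at h
    have hj : join d P a = join d Q a := join_congr (h.mono (by omega))
    simp only [label]
    rw [← hj]
    cases hb : join d P a with
    | none => rfl
    | some b =>
      refine ih (contract_symm hP) (contract_symm hQ) (Agree.contract hP hQ ?_)
      -- Moving to the centre costs `2 * bits n + 1` and reading the contracted graph `6 * bits n +
      -- 3`, whence the `8 * bits n + 4` in `labelRadius`.
      exact Agree.shift (s := 2 * bits n + 1) (h.mono (by omega)) (join_ball hb)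

theorem label_fst_le : (label d m P a).1 ≤ m := by
  induction m generalizing P a with
  | zero => simp [label]
  | succ m ih =>
    simp only [label]
    cases join d P a with
    | none => simp
    | some b => exact ih.trans (Nat.le_succ m)

/-- Go to the centre, through the contracted graph, and back. The path may leave the cluster: only
its weak diameter is bounded. -/
theorem ball_of_label_eq (hP : ∀ a b, P a b → P b a) (h : label d m P a = label d m P b) :
    Ball P (labelRadius n m) a b := by
  induction m generalizing P a b with
  | zero => exact congrArg Prod.snd h
  | succ m ih =>
    simp only [label] at h
    cases ha : join d P a with
    | none =>
      cases hb : join d P b with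
      | none =>
        rw [ha, hb] at h
        rw [show a = b from congrArg Prod.snd h]
        exact Ball.refl _ _
      | some b' =>
        rw [ha, hb] at h
        -- The first component tells clusters that retire now from all later ones.
        have h' : (m + 1, a) = label d m (contract d P) b' := h
        have := label_fst_le (d := d) (m := m) (P := contract d P) (a := b')
        rw [← h'] at this
        simp at this
    | some a' =>
      cases hb : join d P b with
      | none =>
        rw [ha, hb] at h
        have h' : label d m (contract d P) a' = (m + 1, b) := h
        have := label_fst_le (d := d) (m := m) (P := contract d P) (a := a')
        rw [h'] at this
        simp at this
      | some b' =>
        rw [ha, hb] at h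
        have h1 := (ih (contract_symm hP) h).of_stretch (contract_stretch hP)
        exact (((join_ball ha).trans h1).trans ((join_ball hb).symm hP)).mono
          (by simp only [labelRadius]; omega)

theorem card_support_contract (hP : ∀ a b, P a b → P b a) (hr : ∀ a b, P a b → P a a) :
    (support (contract d P)).card * d ≤ (support P).card := by
  classical
  have hR : ∀ x ∈ support (contract d P), Ruling d P x := by
    intro x hx
    obtain ⟨y, -, hy, -⟩ := mem_support.1 hx
    exact join_ruling hy
  have hdisj : ((support (contract d P) : Finset (Fin n)) : Set (Fin n)).PairwiseDisjoint
      (nbrs P) := by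
    intro x hx y hy hxy
    refine Finset.disjoint_left.2 fun z hz hz' => hxy ?_
    exact Ruling.eq_of_common hP (hR x hx) (hR y hy) (mem_nbrs.1 hz) (mem_nbrs.1 hz')
  calc (support (contract d P)).card * d
      ≤ ∑ x ∈ support (contract d P), (nbrs P x).card := by
        rw [← smul_eq_mul]
        exact Finset.card_nsmul_le_sum _ _ _ fun x hx => (Candidate.high (hR x hx)).le
    _ = ((support (contract d P)).biUnion (nbrs P)).card := (Finset.card_biUnion hdisj).symm
    _ ≤ (support P).card := by
        refine Finset.card_le_card fun z hz => ?_
        obtain ⟨x, -, hx⟩ := Finset.mem_biUnion.1 hz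
        exact mem_support.2 (hr _ _ (hP _ _ (mem_nbrs.1 hx)))

/-- Every vertex is adjacent to at most `d` clusters. -/
theorem card_label_nbrs_le (hd : 0 < d) (hP : ∀ a b, P a b → P b a) (hr : ∀ a b, P a b → P a a)
    (hcard : (support P).card ≤ d ^ (m + 1)) (a : Fin n) :
    ((nbrs P a).image (label d m P)).card ≤ d := by
  induction m generalizing P a with
  | zero =>
    refine Finset.card_image_le.trans ((Finset.card_le_card fun b hb => ?_).trans
      (by simpa using hcard))
    exact mem_support.2 (hr _ _ (hP _ _ (mem_nbrs.1 hb)))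
  | succ m ih =>
    rcases le_or_gt (nbrs P a).card d with hlow | hhigh
    · exact Finset.card_image_le.trans hlow
    · by_cases haa : P a a
      · obtain ⟨a', ha'⟩ := Option.ne_none_iff_exists'.1 (join_ne_none hhigh haa)
        have hcard' : (support (contract d P)).card ≤ d ^ (m + 1) := by
          refine Nat.le_of_mul_le_mul_right ?_ hd
          exact (card_support_contract hP hr).trans (hcard.trans (by rw [pow_succ]))
        refine (Finset.card_le_card ?_).trans (ih (contract_symm hP) (contract_refl hr) hcard' a')
        intro l hl
        obtain ⟨b, hb, rfl⟩ := Finset.mem_image.1 hl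
        have hab := mem_nbrs.1 hb
        -- No neighbour of a high-degree vertex retires, so all their labels already occur around
        -- the centre `a'` in the contracted graph.
        obtain ⟨b', hb'⟩ := Option.ne_none_iff_exists'.1 (join_ne_none hhigh (hP _ _ hab))
        refine Finset.mem_image.2 ⟨b', mem_nbrs.2 ⟨a, b, ha', hb', hab⟩, ?_⟩
        simp only [label, hb']
      · have : nbrs P a = ∅ := Finset.eq_empty_of_forall_notMem fun b hb =>
          haa (hr _ _ (mem_nbrs.1 hb))
        simp [this]

/-! ### Selection by minimum hitting sets -/

/-- `D` meets all members of the family `𝓕`. -/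
def Hits (𝓕 : Set (Finset (Fin n))) (D : Finset (Fin n)) : Prop :=
  ∀ s ∈ 𝓕, ∃ x ∈ D, x ∈ s

open Classical in
/-- A minimum hitting set of the family `𝓕`; it depends on nothing but `𝓕`. -/
noncomputable def minHit (𝓕 : Set (Finset (Fin n))) : Finset (Fin n) :=
  if h : ∃ D, Hits 𝓕 D ∧ ∀ D', Hits 𝓕 D' → D.card ≤ D'.card then h.choose else ∅

theorem minHit_spec {𝓕 : Set (Finset (Fin n))} (h : ∃ D, Hits 𝓕 D) :
    Hits 𝓕 (minHit 𝓕) ∧ ∀ D, Hits 𝓕 D → (minHit 𝓕).card ≤ D.card := by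
  classical
  have h' : ∃ D, Hits 𝓕 D ∧ ∀ D', Hits 𝓕 D' → D.card ≤ D'.card := by
    obtain ⟨D₀, h₀⟩ := h
    obtain ⟨D, hD, hmin⟩ := Finset.exists_min_image (Finset.univ.filter (Hits 𝓕)) Finset.card
      ⟨D₀, by simp [h₀]⟩
    exact ⟨D, (Finset.mem_filter.1 hD).2, fun D' hD' => hmin D' (by simp [hD'])⟩
  unfold minHit
  rw [dif_pos h']
  exact h'.choose_spec

/-- The neighbourhoods of the vertices of the cluster named `l`. -/
def clusterNbrs (d m : ℕ) (P : Fin n → Fin n → Prop) (l : ℕ × Fin n) : Set (Finset (Fin n)) :=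
  {s | ∃ y, label d m P y = l ∧ nbrs P y = s}

/-- `v` is selected by one of the clusters in its neighbourhood. -/
def Selected (d m : ℕ) (P : Fin n → Fin n → Prop) (v : Fin n) : Prop :=
  ∃ x, P v x ∧ v ∈ minHit (clusterNbrs d m P (label d m P x))

/-- One radius reaches all members of the cluster, the second determines their labels. -/
theorem clusterNbrs_subset (hP : ∀ a b, P a b → P b a) (hQ : ∀ a b, Q a b → Q b a)
    (h : Agree P Q (labelRadius n m + labelRadius n m) x) :
    clusterNbrs d m P (label d m P x) ⊆ clusterNbrs d m Q (label d m Q x) := by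
  rintro s ⟨y, hy, rfl⟩
  have hA : Agree P Q (labelRadius n m) y :=
    h.shift ((ball_of_label_eq hP hy).symm hP)
  refine ⟨y, ?_, hA.nbrs_eq.symm⟩
  rw [← label_congr hP hQ hA, hy, label_congr hP hQ (h.mono (by omega))]

theorem Selected.of_agree (hP : ∀ a b, P a b → P b a) (hQ : ∀ a b, Q a b → Q b a)
    (h : Agree P Q (labelRadius n m + labelRadius n m + 1) a) :
    Selected d m P a ↔ Selected d m Q a := by
  refine exists_congr fun x => ?_
  rw [← h.here x]
  refine and_congr_right fun hx => ?_
  have hA : Agree P Q (labelRadius n m + labelRadius n m) x := h.shift (Ball.single hx)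
  rw [(clusterNbrs_subset hP hQ hA).antisymm (clusterNbrs_subset hQ hP hA.symm)]

theorem exists_hits_clusterNbrs (hrefl : ∀ a, P a a) (l : ℕ × Fin n) :
    ∃ D, Hits (clusterNbrs d m P l) D := by
  refine ⟨Finset.univ, ?_⟩
  rintro s ⟨y, -, rfl⟩
  exact ⟨y, Finset.mem_univ y, mem_nbrs.2 (hrefl y)⟩

theorem exists_selected_nbr (hP : ∀ a b, P a b → P b a) (hrefl : ∀ a, P a a) (v : Fin n) :
    ∃ u, Selected d m P u ∧ P u v := by
  obtain ⟨u, hu, huv⟩ := (minHit_spec (exists_hits_clusterNbrs (d := d) (m := m) hrefl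
    (label d m P v))).1 (nbrs P v) ⟨v, rfl, rfl⟩
  have huv := hP _ _ (mem_nbrs.1 huv)
  exact ⟨u, ⟨v, huv, hu⟩, huv⟩

/-- The selected vertices outnumber the members of any dominating set by a factor of at most `d`. -/
theorem card_selected_le (hd : 0 < d) (hP : ∀ a b, P a b → P b a) (hrefl : ∀ a, P a a)
    (hn : n ≤ d ^ (m + 1)) {W : Finset (Fin n)} (hW : ∀ v, ∃ w ∈ W, P w v)
    {U : Finset (Fin n)} (hU : ∀ v ∈ U, Selected d m P v) : U.card ≤ d * W.card := by
  classical
  let lab := label d m P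
  let I : Finset (ℕ × Fin n) := Finset.univ.image lab
  calc U.card ≤ (I.biUnion fun l => minHit (clusterNbrs d m P l)).card := by
        refine Finset.card_le_card fun v hv => ?_
        obtain ⟨x, -, hx⟩ := hU v hv
        exact Finset.mem_biUnion.2 ⟨_, Finset.mem_image_of_mem _ (Finset.mem_univ x), hx⟩
    _ ≤ ∑ l ∈ I, (minHit (clusterNbrs d m P l)).card := Finset.card_biUnion_le
    -- The members of `W` near the cluster compete with its minimum hitting set.
    _ ≤ ∑ l ∈ I, (W.filter fun w => l ∈ (nbrs P w).image lab).card := by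
        refine Finset.sum_le_sum fun l _ => ?_
        refine (minHit_spec (exists_hits_clusterNbrs hrefl l)).2 _ ?_
        rintro s ⟨y, hy, rfl⟩
        obtain ⟨w, hw, hwy⟩ := hW y
        exact ⟨w, Finset.mem_filter.2 ⟨hw, Finset.mem_image.2 ⟨y, mem_nbrs.2 hwy, hy⟩⟩,
          mem_nbrs.2 (hP _ _ hwy)⟩
    _ = ∑ w ∈ W, (I.filter fun l => l ∈ (nbrs P w).image lab).card :=
        Finset.sum_card_bipartiteAbove_eq_sum_card_bipartiteBelow _
    _ ≤ ∑ w ∈ W, d := by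
        refine Finset.sum_le_sum fun w _ => ?_
        refine (Finset.card_le_card fun l hl => (Finset.mem_filter.1 hl).2).trans ?_
        refine card_label_nbrs_le hd hP (fun a _ _ => hrefl a) (le_trans ?_ hn) w
        simpa using Finset.card_le_univ (support P)
    _ = d * W.card := by rw [Finset.sum_const, smul_eq_mul, mul_comm]

end Clusters

end LocalClustering

/-! ### The distributed algorithm -/

namespace LocalClustering

/-- The number of rounds. -/
noncomputable def rounds (n k : ℕ) : ℕ :=
  if n ≤ 1 ∨ k ≤ 1 then 0 else (24 * bits n + 18) ^ (k - 1)

/-- The number of neighbours beyond which a cluster does not retire. -/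
noncomputable def degreeBound (n k : ℕ) : ℕ := ⌈(n : ℝ) ^ (1 / (k : ℝ))⌉₊

/-- What a vertex knows after `clock` rounds: the global data, its identity number, and the
edges `known`, given by the identity numbers of their ends. -/
structure Knowledge where
  n : ℕ
  k : ℕ
  id : ℕ
  clock : ℕ
  known : Finset (ℕ × ℕ)

/-- The reflexive graph with the edges in `K`, where the identity number of `a` is `a + 1`. -/
def viewGraph (n : ℕ) (K : Finset (ℕ × ℕ)) (a b : Fin n) : Prop :=
  a = b ∨ ((a : ℕ) + 1, (b : ℕ) + 1) ∈ K ∨ ((b : ℕ) + 1, (a : ℕ) + 1) ∈ K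

/-- Whether a vertex decides to belong to the dominating set. -/
def Knowledge.Decides (s : Knowledge) : Prop :=
  (s.n ≤ 1 ∨ s.k ≤ 1) ∨ ∃ v : Fin s.n, (v : ℕ) + 1 = s.id ∧
    Selected (degreeBound s.n s.k) (s.k - 1) (viewGraph s.n s.known) v

open Classical in
/-- All vertices collect what is known in their neighbourhoods until the time is up. -/
noncomputable def clusterAlgorithm : DistributedAlgorithm ℕ Bool where
  State := Knowledge
  Msg := ℕ × Finset (ℕ × ℕ)
  init k n id _ := ⟨n, k, id, 0, ∅⟩
  send s _ := (s.id, s.known)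
  receive s d f :=
    { s with
      clock := s.clock + 1
      known := s.known ∪ Finset.univ.biUnion fun p : Fin d =>
        match f p with
        | some μ => insert (s.id, μ.1) μ.2
        | none => ∅ }
  output s := if rounds s.n s.k ≤ s.clock then some (decide s.Decides) else none

theorem Ball.head {α : Type*} {P : α → α → Prop} {r : ℕ} {a b : α} (h : Ball P (r + 1) a b) :
    ∃ c, (a = c ∨ P a c) ∧ Ball P r c b := by
  induction r generalizing b with
  | zero =>
    obtain ⟨e, rfl, h⟩ := h
    exact ⟨b, h, rfl⟩
  | succ r ih =>
    obtain ⟨e, he, heb⟩ := h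
    obtain ⟨c, hc, hce⟩ := ih he
    exact ⟨c, hc, e, hce, heb⟩

/-! ### Gathering the surroundings and correctness of the output -/

section Gathering

variable {V : Type*} [Fintype V] {G : SimpleGraph V} (N : Network G) (k : ℕ)

theorem known_sound_complete (t : ℕ) (ht : t ≤ rounds (Fintype.card V) k) (v : V) :
    ∃ K : Finset (ℕ × ℕ),
      clusterAlgorithm.stateAfter N k t v = Knowledge.mk (Fintype.card V) k (N.id v) t K ∧
      (∀ e ∈ K, ∃ x y, G.Adj x y ∧ e = (N.id x, N.id y)) ∧
      ∀ r < t, ∀ x, Ball G.Adj r v x → ∀ y, G.Adj x y → (N.id x, N.id y) ∈ K := by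
  classical
  induction t generalizing v with
  | zero => exact ⟨∅, rfl, by simp, by simp⟩
  | succ t ih =>
    choose K hK hsound hcomplete using fun v => ih (by omega) v
    -- All vertices stop at the same deadline, so no message is lost before it.
    have hout : ∀ u, clusterAlgorithm.output (clusterAlgorithm.stateAfter N k t u) = none := by
      intro u
      rw [hK u]
      exact if_neg (by simp only; omega)
    refine ⟨K v ∪ Finset.univ.biUnion fun p : Fin (N.deg v) =>
      insert (N.id v, N.id (N.port v p)) (K (N.port v p)), ?_, ?_, ?_⟩
    · have hrec : ∀ p, clusterAlgorithm.received N (clusterAlgorithm.stateAfter N k t) v p =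
          some (N.id (N.port v p), K (N.port v p)) := by
        intro p
        simp only [DistributedAlgorithm.received, hout]
        rw [hK]
        rfl
      change clusterAlgorithm.round N (clusterAlgorithm.stateAfter N k t) v = _
      simp only [DistributedAlgorithm.round, hout]
      rw [funext hrec, hK v]
      rfl
    · intro e he
      rcases Finset.mem_union.1 he with he | he
      · exact hsound v e he
      · obtain ⟨p, -, hp⟩ := Finset.mem_biUnion.1 he
        rcases Finset.mem_insert.1 hp with rfl | hp
        · exact ⟨v, N.port v p, (N.port v p).2, rfl⟩
        · exact hsound _ e hp
    · intro r hr x hx y hxy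
      have hport : ∀ u, G.Adj v u → ∃ p, ((N.port v p : G.neighborSet v) : V) = u := fun u hu =>
        ⟨(N.port v).symm ⟨u, hu⟩, by simp⟩
      cases r with
      | zero =>
        cases hx
        obtain ⟨p, rfl⟩ := hport y hxy
        exact Finset.mem_union_right _
          (Finset.mem_biUnion.2 ⟨p, Finset.mem_univ p, Finset.mem_insert_self _ _⟩)
      | succ r =>
        obtain ⟨u, hu, hux⟩ := hx.head
        rcases hu with rfl | hu
        · exact Finset.mem_union_left _ (hcomplete v r (by omega) x hux y hxy)
        · obtain ⟨p, rfl⟩ := hport u hu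
          exact Finset.mem_union_right _ (Finset.mem_biUnion.2 ⟨p, Finset.mem_univ p,
            Finset.mem_insert_of_mem (hcomplete _ r (by omega) x hux y hxy)⟩)

/-- The vertices, numbered by their identity numbers. -/
noncomputable def numbering : V ≃ Fin (Fintype.card V) :=
  Equiv.ofBijective
    (fun v => ⟨N.id v - 1, by have := Finset.mem_Icc.1 (N.id_mem v); omega⟩) <| by
    rw [Fintype.bijective_iff_injective_and_card]
    refine ⟨fun v w h => N.id_injective ?_, by simp⟩
    have h1 := Finset.mem_Icc.1 (N.id_mem v)
    have h2 := Finset.mem_Icc.1 (N.id_mem w)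
    have := congrArg Fin.val h
    simp only at this
    omega

theorem numbering_add_one (v : V) : (numbering N v : ℕ) + 1 = N.id v := by
  have := Finset.mem_Icc.1 (N.id_mem v)
  simp only [numbering, Equiv.ofBijective_apply]
  omega

/-- The reflexive graph of the network on the numbers of its vertices. -/
def numberedGraph (a b : Fin (Fintype.card V)) : Prop :=
  a = b ∨ G.Adj ((numbering N).symm a) ((numbering N).symm b)

theorem numberedGraph_symm (a b : Fin (Fintype.card V)) (h : numberedGraph N a b) :
    numberedGraph N b a := h.imp Eq.symm fun h' => h'.symm

theorem viewGraph_symm {n : ℕ} {K : Finset (ℕ × ℕ)} (a b : Fin n) (h : viewGraph n K a b) :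
    viewGraph n K b a := h.imp Eq.symm Or.symm

theorem numberedGraph_iff {v w : V} :
    numberedGraph N (numbering N v) (numbering N w) ↔ v = w ∨ G.Adj v w := by
  simp [numberedGraph]

theorem ball_adj_of_numberedGraph {r : ℕ} {v : V} {b : Fin (Fintype.card V)}
    (h : Ball (numberedGraph N) r (numbering N v) b) : Ball G.Adj r v ((numbering N).symm b) := by
  induction r generalizing b with
  | zero => cases h; exact ((numbering N).symm_apply_apply v).symm
  | succ r ih =>
    obtain ⟨e, he, heb⟩ := h
    refine ⟨_, ih he, ?_⟩
    rcases heb with rfl | rfl | heb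
    · exact Or.inl rfl
    · exact Or.inl rfl
    · exact Or.inr heb

theorem agree_viewGraph {K : Finset (ℕ × ℕ)} {t r : ℕ} {v : V} (hr : r < t)
    (hsound : ∀ e ∈ K, ∃ x y, G.Adj x y ∧ e = (N.id x, N.id y))
    (hcomplete : ∀ r < t, ∀ x, Ball G.Adj r v x → ∀ y, G.Adj x y → (N.id x, N.id y) ∈ K) :
    Agree (numberedGraph N) (viewGraph (Fintype.card V) K) r (numbering N v) := by
  intro a ha b
  have hball := ball_adj_of_numberedGraph N ha
  obtain ⟨x, rfl⟩ := (numbering N).surjective a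
  obtain ⟨y, rfl⟩ := (numbering N).surjective b
  have key : ∀ {x y}, (N.id x, N.id y) ∈ K → G.Adj x y := by
    intro x y h
    obtain ⟨x', y', hadj, he⟩ := hsound _ h
    rw [Prod.mk.injEq] at he
    rwa [N.id_injective he.1, N.id_injective he.2]
  rw [numberedGraph_iff]
  simp only [viewGraph, numbering_add_one, (numbering N).injective.eq_iff]
  refine or_congr_right ⟨fun h => Or.inl ?_, ?_⟩
  · exact hcomplete r hr x (by simpa using hball) y h
  · rintro (h | h)
    · exact key h
    · exact (key h).symm

open Classical in
/-- The output of the algorithm. -/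
noncomputable def clusterOutput (v : V) : Bool :=
  decide ((Fintype.card V ≤ 1 ∨ k ≤ 1) ∨
    Selected (degreeBound (Fintype.card V) k) (k - 1) (numberedGraph N) (numbering N v))

theorem labelRadius_add_one_le (n m : ℕ) : labelRadius n m + 1 ≤ (12 * bits n + 9) ^ m := by
  induction m with
  | zero => simp [labelRadius]
  | succ m ih =>
    rw [pow_succ, labelRadius]
    nlinarith [Nat.mul_le_mul_right (12 * bits n + 9) ih,
      Nat.zero_le (bits n * labelRadius n m)]

theorem lt_rounds {n : ℕ} (h : ¬(n ≤ 1 ∨ k ≤ 1)) :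
    labelRadius n (k - 1) + labelRadius n (k - 1) + 1 < rounds n k := by
  rw [rounds, if_neg h]
  have h1 := labelRadius_add_one_le n (k - 1)
  -- As `k ≥ 2`, doubling the base pays for the two radii in `Selected.of_agree`.
  have h2 : 2 ^ 1 ≤ 2 ^ (k - 1) := Nat.pow_le_pow_right (by norm_num) (by omega)
  have h3 : (24 * bits n + 18) ^ (k - 1) = 2 ^ (k - 1) * (12 * bits n + 9) ^ (k - 1) := by
    rw [← mul_pow]; congr 1; ring
  have h4 := Nat.mul_le_mul h2 h1
  omega

theorem clusterAlgorithm_computesWithin :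
    clusterAlgorithm.ComputesWithin N k (rounds (Fintype.card V) k) (clusterOutput N k) := by
  intro v
  obtain ⟨K, hK, hsound, hcomplete⟩ := known_sound_complete N k _ le_rfl v
  rw [hK]
  refine (if_pos le_rfl).trans (congrArg some ?_)
  unfold clusterOutput
  rw [decide_eq_decide]
  simp only [Knowledge.Decides]
  by_cases h : Fintype.card V ≤ 1 ∨ k ≤ 1
  · simp [h]
  · refine or_congr_right ?_
    rw [Selected.of_agree (numberedGraph_symm N) viewGraph_symm
      (agree_viewGraph N (lt_rounds k h) hsound hcomplete)]
    constructor
    · rintro ⟨w, hw, hsel⟩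
      rw [← numbering_add_one] at hw
      rwa [← Fin.ext (Nat.succ_injective hw)]
    · exact fun hsel => ⟨_, numbering_add_one N v, hsel⟩

end Gathering

/-! ### Numerical bounds -/

section Bounds

/-- For `n = 1` and `k ≥ 2` the right side vanishes, which forces the zero-round case of `rounds`.
-/
theorem rounds_le (n k : ℕ) :
    (rounds n k : ℝ) ≤ (130 * Real.log n) ^ (k - 1) := by
  unfold rounds
  split_ifs with h
  · have : 0 ≤ Real.log (n : ℝ) := Real.log_natCast_nonneg n
    simp only [Nat.cast_zero]
    positivity
  · push_cast
    refine pow_le_pow_left₀ (by positivity) ?_ _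
    have hn : 2 ≤ n := by omega
    have hb : 1 ≤ bits n := Nat.clog_pos (by norm_num) hn
    have hpow : 2 ^ (bits n - 1) < n := Nat.pow_pred_clog_lt_self (by norm_num) (by omega)
    have h1 : ((bits n : ℝ) - 1) * Real.log 2 ≤ Real.log n := by
      have : Real.log ((2 : ℝ) ^ (bits n - 1)) ≤ Real.log n :=
        Real.log_le_log (by positivity) (by exact_mod_cast hpow.le)
      rwa [Real.log_pow, Nat.cast_sub hb, Nat.cast_one] at this
    have h2 : Real.log 2 ≤ Real.log n := Real.log_le_log (by norm_num) (by exact_mod_cast hn)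
    have h3 := Real.log_two_gt_d9
    have hb' : (1 : ℝ) ≤ bits n := by exact_mod_cast hb
    -- With b = `bits n`, 24b + 18 = 24(b - 1) + 42 ≤ (66 / log 2) log n, and 66 / log 2 < 130.
    nlinarith

theorem le_degreeBound_pow (n : ℕ) {k : ℕ} (hk : 1 ≤ k) : n ≤ degreeBound n k ^ k := by
  have h : (n : ℝ) ^ (1 / (k : ℝ)) ≤ degreeBound n k := Nat.le_ceil _
  have h1 : ((n : ℝ) ^ (1 / (k : ℝ))) ^ k = n := by
    rw [one_div, Real.rpow_inv_natCast_pow (by positivity) (by omega)]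
  have h2 := pow_le_pow_left₀ (by positivity) h k
  rw [h1] at h2
  exact_mod_cast h2

theorem degreeBound_le {n : ℕ} (hn : 1 ≤ n) (k : ℕ) :
    (degreeBound n k : ℝ) ≤ 2 * (n : ℝ) ^ (1 / (k : ℝ)) := by
  have h1 : (1 : ℝ) ≤ (n : ℝ) ^ (1 / (k : ℝ)) :=
    Real.one_le_rpow (by exact_mod_cast hn) (by positivity)
  have h2 := Nat.ceil_lt_add_one (zero_le_one.trans h1)
  unfold degreeBound
  linarith

end Bounds

/-! ### Domination and the approximation ratio -/

section Approximation

variable {V : Type*} [Fintype V] {G : SimpleGraph V} (N : Network G) {k : ℕ}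

theorem mem_filter_clusterOutput {v : V} :
    v ∈ (Finset.univ.filter fun v => clusterOutput N k v = true) ↔
      (Fintype.card V ≤ 1 ∨ k ≤ 1) ∨
        Selected (degreeBound (Fintype.card V) k) (k - 1) (numberedGraph N) (numbering N v) := by
  rw [Finset.mem_filter, and_iff_right (Finset.mem_univ v)]
  classical
  exact decide_eq_true_iff

theorem clusterOutput_isDominatingSet :
    G.IsDominatingSet (Finset.univ.filter fun v => clusterOutput N k v = true) := by
  intro v hv
  rw [mem_filter_clusterOutput, not_or] at hv
  obtain ⟨u, hu, huv⟩ := exists_selected_nbr (d := degreeBound (Fintype.card V) k) (m := k - 1)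
    (numberedGraph_symm N) (fun a => Or.inl rfl) (numbering N v)
  obtain ⟨u, rfl⟩ := (numbering N).surjective u
  rcases (numberedGraph_iff N).1 huv with rfl | huv
  · exact absurd hu hv.2
  · exact ⟨u, (mem_filter_clusterOutput N).2 (Or.inr hu), huv⟩

theorem card_clusterOutput_le (hk : 1 ≤ k) {W : Finset V} (hW : G.IsDominatingSet W) :
    ((Finset.univ.filter fun v => clusterOutput N k v = true).card : ℝ) ≤
      2 * (Fintype.card V : ℝ) ^ (1 / (k : ℝ)) * W.card := by
  rcases isEmpty_or_nonempty V with hV | ⟨⟨v₀⟩⟩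
  · simp only [Finset.univ_eq_empty, Finset.filter_empty, Finset.card_empty, Nat.cast_zero]
    positivity
  have hn : 1 ≤ Fintype.card V := Fintype.card_pos_iff.2 ⟨v₀⟩
  have hpow : (1 : ℝ) ≤ (Fintype.card V : ℝ) ^ (1 / (k : ℝ)) :=
    Real.one_le_rpow (by exact_mod_cast hn) (by positivity)
  by_cases h : Fintype.card V ≤ 1 ∨ k ≤ 1
  · have hW1 : (1 : ℝ) ≤ W.card := by
      have : W.Nonempty := by
        by_cases hv : v₀ ∈ W
        · exact ⟨v₀, hv⟩
        · obtain ⟨u, hu, -⟩ := hW v₀ hv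
          exact ⟨u, hu⟩
      exact_mod_cast this.card_pos
    -- In the zero-round case every vertex is selected, which the ratio allows.
    have hle : (Fintype.card V : ℝ) ≤ (Fintype.card V : ℝ) ^ (1 / (k : ℝ)) := by
      rcases h with h | h
      · exact le_trans (by exact_mod_cast h) hpow
      · simp [le_antisymm h hk]
    have hU : ((Finset.univ.filter fun v => clusterOutput N k v = true).card : ℝ) ≤
        Fintype.card V := by exact_mod_cast Finset.card_le_univ _
    nlinarith
  · have hd : 0 < degreeBound (Fintype.card V) k := Nat.ceil_pos.2 (zero_lt_one.trans_le hpow)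
    have key := card_selected_le (m := k - 1) hd (numberedGraph_symm N) (fun a => Or.inl rfl)
      (by rw [Nat.sub_add_cancel hk]; exact le_degreeBound_pow _ hk)
      (W := W.map (numbering N).toEmbedding) (by
        intro a
        obtain ⟨v, rfl⟩ := (numbering N).surjective a
        by_cases hv : v ∈ W
        · exact ⟨_, Finset.mem_map_of_mem _ hv, Or.inl rfl⟩
        · obtain ⟨u, hu, huv⟩ := hW v hv
          exact ⟨_, Finset.mem_map_of_mem _ hu, (numberedGraph_iff N).2 (Or.inr huv)⟩)
      (U := (Finset.univ.filter fun v => clusterOutput N k v = true).map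
        (numbering N).toEmbedding) (by
        intro a ha
        obtain ⟨v, hv, rfl⟩ := Finset.mem_map.1 ha
        exact ((mem_filter_clusterOutput N).1 hv).resolve_left h)
    rw [Finset.card_map, Finset.card_map] at key
    calc ((Finset.univ.filter fun v => clusterOutput N k v = true).card : ℝ)
        ≤ degreeBound (Fintype.card V) k * W.card := by exact_mod_cast key
      _ ≤ _ := mul_le_mul_of_nonneg_right (degreeBound_le hn k) (Nat.cast_nonneg _)

end Approximation

end LocalClustering

theorem mainTheorem9 :
    ∃ (A : DistributedAlgorithm ℕ Bool) (C c : ℝ), 0 < C ∧ 0 < c ∧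
      ∀ (k : ℕ), 1 ≤ k → ∀ (V : Type*) [Fintype V] (G : SimpleGraph V) (N : Network G),
        ∃ (T : ℕ) (D : V → Bool),
          A.ComputesWithin N k T D ∧
          (T : ℝ) ≤ (c * Real.log (Fintype.card V)) ^ (k - 1) ∧
          G.IsApproxMinDominatingSet (C * (Fintype.card V : ℝ) ^ (1 / (k : ℝ)))
            (Finset.univ.filter fun v => D v = true) := by
  refine ⟨LocalClustering.clusterAlgorithm, 2, 130, by norm_num, by norm_num,
    fun k hk V _ G N => ⟨_, _, LocalClustering.clusterAlgorithm_computesWithin N k,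
      LocalClustering.rounds_le _ k, LocalClustering.clusterOutput_isDominatingSet N,
      fun W hW => LocalClustering.card_clusterOutput_le N hk hW.1⟩⟩
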